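/- Let $k$ be a field and $\beta\in k$ (for instance $k=\mathbb{C}(\beta)$ with $\beta$ an indeterminate). For a partition $\lambda=(\lambda_1\ge\lambda_2\ge\cdots)$ of length $\ell(\lambda)$ (with $\lambda_i=0$ for $i>\ell(\lambda)$) and $n\ge\ell(\lambda)$ let $$G_\lambda(x_1,\dots,x_n)=\frac{\det\bigl(x_i^{\lambda_j+n-j}(1+\beta x_i)^{j-1}\bigr)_{1\le i,j\le n}}{\prod_{1\le i<j\le n}(x_i-x_j)}\in k[x_1,\dots,x_n],$$ and let the stable Grothendieck polynomial $G_\lambda(x)\in k[[x_1,x_2,\dots]]$ be the unique formal power series with $G_\lambda(x_1,\dots,x_n,0,0,\dots)=G_\lambda(x_1,\dots,x_n)$ for all $n\ge\ell(\lambda)$. Put $G_n(x)=G_{(n)}(x)$ for $n\ge 1$, $G_0(x)=G_\varnothing(x)$ and $G_{n}(x)=(-\beta)^{-n}$ for $n<0$. All infinite sums and products below are taken coefficientwise in formal power series. (1) The functions $G_n(x)$ have the generating function $$\sum_{n\in\mathbb{Z}}G_n(x)z^n=\frac{1}{1+\beta z^{-1}}\prod_{i=1}^\infty\frac{1+\beta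 x_i}{1-x_iz},\qquad \frac1{1+\beta z^{-1}}=\sum_{m\ge0}(-\beta)^mz^{-m}.$$ That is, the product over $i$ converges in $k[[x_1,x_2,\dots]][[z]]$, and, writing $A_p$ for its coefficient of $z^p$ (with $A_p=0$ for $p<0$), the series $\sum_{m\ge0}(-\beta)^mA_{n+m}$ converges to $G_n(x)$ for every $n\in\mathbb{Z}$. (2) For every partition $\lambda$ and every integer $r\ge\ell(\lambda)$, the series $\sum_{m\ge0}\binom{i-r}{m}\beta^mG_{\lambda_i-i+j+m}(x)$ converges for all $1\le i,j\le r$, and $$G_\lambda(x)=\det\left(\sum_{m=0}^\infty\binom{i-r}{m}\beta^m\,G_{\lambda_i-i+j+m}(x)\right)_{1\le i,j\le r}.$$ Here $\binom{a}{m}=a(a-1)\cdots(a-m+1)/m!$ for every integer $a$. -/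

import Mathlib

open scoped MvPowerSeries.WithPiTopology PowerSeries.WithPiTopology

namespace StableGrothendieck

variable {k : Type*} [Field k]

/-- The numerator `det (x_i ^ (λ_j + n - j) (1 + β x_i) ^ (j - 1))`, `1 ≤ i, j ≤ n`, of the ratio
formula. Rows and columns are numbered from `0` here, so that `lam j` is the part `λ_{j+1}`. -/
noncomputable def ratioNum (β : k) (lam : ℕ → ℕ) (n : ℕ) : MvPolynomial (Fin n) k :=
  Matrix.det (Matrix.of fun i j : Fin n =>
    MvPolynomial.X i ^ (lam j + (n - 1 - (j : ℕ))) *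
      (1 + MvPolynomial.C β * MvPolynomial.X i) ^ (j : ℕ))

/-- The denominator `∏_{i < j} (x_i - x_j)` of the ratio formula. -/
noncomputable def ratioDen (k : Type*) [Field k] (n : ℕ) : MvPolynomial (Fin n) k :=
  ∏ i : Fin n, ∏ j ∈ Finset.Ioi i, (MvPolynomial.X i - MvPolynomial.X j)

theorem ratioDen_ne_zero (n : ℕ) : ratioDen k n ≠ 0 := by
  unfold ratioDen
  refine Finset.prod_ne_zero_iff.2 fun i _ => Finset.prod_ne_zero_iff.2 fun j hj => ?_
  rw [sub_ne_zero]
  intro h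
  have := MvPolynomial.X_injective h
  simp [this] at hj

/-- The denominator divides the numerator, so that the ratio is a polynomial. -/
theorem exists_ratio (β : k) (lam : ℕ → ℕ) (n : ℕ) :
    ∃ p : MvPolynomial (Fin n) k, p * ratioDen k n = ratioNum β lam n := by
  classical
  let R := MvPolynomial (Fin n) k
  let v : Fin n → R := MvPolynomial.X
  let P : Fin n → Polynomial R := fun j =>
    Polynomial.X ^ (lam j + (n - 1 - (j : ℕ))) *
      (1 + Polynomial.C (MvPolynomial.C β) * Polynomial.X) ^ (j : ℕ)
  let M : Polynomial R := ∏ i, (Polynomial.X - Polynomial.C (v i))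
  have hM : M.Monic := Polynomial.monic_prod_of_monic _ _ fun i _ => Polynomial.monic_X_sub_C _
  have hdeg : M.natDegree = n := by
    rw [Polynomial.natDegree_prod_of_monic _ _ fun i _ => Polynomial.monic_X_sub_C _]
    simp
  let Q : Fin n → Polynomial R := fun j => P j %ₘ M
  have hQ : ∀ i j, (Q j).eval (v i) = (P j).eval (v i) := by
    intro i j
    have h := congrArg (Polynomial.eval (v i)) (Polynomial.modByMonic_add_div (P j) M)
    have h0 : M.eval (v i) = 0 := by
      simp only [M, Polynomial.eval_prod]
      exact Finset.prod_eq_zero (Finset.mem_univ i) (by simp)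
    simpa [h0, Q] using h
  have hlt : ∀ j, Q j = ∑ l : Fin n, Polynomial.C ((Q j).coeff l) * Polynomial.X ^ (l : ℕ) := by
    intro j
    have hn : (Q j).degree < n := by
      have := Polynomial.degree_modByMonic_lt (P j) hM
      rwa [Polynomial.degree_eq_natDegree hM.ne_zero, hdeg] at this
    conv_lhs => rw [Polynomial.as_sum_range_C_mul_X_pow' (Q j)
      (n := n) (by
        by_cases h : Q j = 0
        · simp only [h, Polynomial.natDegree_zero]
          exact Fin.pos j
        · exact (Polynomial.natDegree_lt_iff_degree_lt h).2 hn)]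
    rw [Finset.sum_range]
  have hnum : ratioNum β lam n =
      (Matrix.vandermonde v).det * (Matrix.of fun l j : Fin n => (Q j).coeff l).det := by
    rw [← Matrix.det_mul]
    unfold ratioNum
    congr 1
    ext1 i j
    have : (P j).eval (v i) = v i ^ (lam j + (n - 1 - (j : ℕ))) *
        (1 + MvPolynomial.C β * v i) ^ (j : ℕ) := by
      simp [P]
    have hsum : (Q j).eval (v i) = ∑ l : Fin n, (Q j).coeff l * v i ^ (l : ℕ) := by
      conv_lhs => rw [hlt j, Polynomial.eval_finsetSum]
      simp only [Polynomial.eval_mul, Polynomial.eval_C, Polynomial.eval_pow, Polynomial.eval_X]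
    rw [Matrix.of_apply, ← this, ← hQ i j, hsum, Matrix.mul_apply]
    refine Finset.sum_congr rfl fun l _ => ?_
    rw [Matrix.vandermonde_apply, Matrix.of_apply, mul_comm]
  have hden : (Matrix.vandermonde v).det =
      (∏ i : Fin n, ∏ _j ∈ Finset.Ioi i, (-1 : R)) * ratioDen k n := by
    rw [Matrix.det_vandermonde, ratioDen, ← Finset.prod_mul_distrib]
    refine Finset.prod_congr rfl fun i _ => ?_
    rw [← Finset.prod_mul_distrib]
    exact Finset.prod_congr rfl fun j _ => by simp only [v]; ring
  refine ⟨(∏ i : Fin n, ∏ _j ∈ Finset.Ioi i, (-1 : R)) *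
    (Matrix.of fun l j : Fin n => (Q j).coeff l).det, ?_⟩
  rw [hnum, hden]
  ring

/-- The Grothendieck polynomial `G_λ(x_1, …, x_n)`: the polynomial quotient in the ratio formula
`det (x_i ^ (λ_j + n - j) (1 + β x_i) ^ (j - 1)) / ∏_{i < j} (x_i - x_j)`. -/
noncomputable def grothendieckPoly (β : k) (lam : ℕ → ℕ) (n : ℕ) : MvPolynomial (Fin n) k :=
  (exists_ratio β lam n).choose

theorem grothendieckPoly_mul_ratioDen (β : k) (lam : ℕ → ℕ) (n : ℕ) :
    grothendieckPoly β lam n * ratioDen k n = ratioNum β lam n :=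
  (exists_ratio β lam n).choose_spec

/-- The specialization `F(x_1, …, x_n, 0, 0, …)`; the variables of `F` are numbered from `0`. -/
noncomputable def restrictVars (n : ℕ) (F : MvPowerSeries ℕ k) : MvPowerSeries (Fin n) k :=
  MvPowerSeries.killCompl Fin.valEmbedding F

theorem stability (β : k) (lam : ℕ → ℕ) (n : ℕ) (h : lam n = 0) :
    MvPowerSeries.killCompl Fin.castSuccEmb
        (grothendieckPoly β lam (n + 1) : MvPowerSeries (Fin (n + 1)) k) =
      (grothendieckPoly β lam n : MvPowerSeries (Fin n) k) := by
  classical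
  let K : MvPowerSeries (Fin (n + 1)) k →ₐ[k] MvPowerSeries (Fin n) k :=
    MvPowerSeries.killCompl Fin.castSuccEmb
  have hX : ∀ i : Fin n, K (MvPowerSeries.X i.castSucc) = MvPowerSeries.X i := fun i =>
    MvPowerSeries.killCompl_X (e := Fin.castSuccEmb) i
  have hXl : K (MvPowerSeries.X (Fin.last n)) = 0 :=
    MvPowerSeries.killCompl_X_eq_zero (by
      rintro ⟨i, hi⟩
      exact (Fin.castSucc_lt_last i).ne hi)
  have hC : K (MvPowerSeries.C β) = MvPowerSeries.C β := MvPowerSeries.killCompl_C β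
  let Φ : MvPolynomial (Fin (n + 1)) k →+* MvPowerSeries (Fin n) k :=
    (K : _ →+* _).comp MvPolynomial.coeToMvPowerSeries.ringHom
  let Ψ : MvPolynomial (Fin n) k →+* MvPowerSeries (Fin n) k :=
    MvPolynomial.coeToMvPowerSeries.ringHom
  have ΦX : ∀ i : Fin n, Φ (MvPolynomial.X i.castSucc) = MvPowerSeries.X i := fun i => by
    simpa [Φ] using hX i
  have ΦXl : Φ (MvPolynomial.X (Fin.last n)) = 0 := by simpa [Φ] using hXl
  have ΦC : Φ (MvPolynomial.C β) = MvPowerSeries.C β := by simpa [Φ] using hC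
  have ΨX : ∀ i : Fin n, Ψ (MvPolynomial.X i) = MvPowerSeries.X i := fun i => by simp [Ψ]
  have ΨC : Ψ (MvPolynomial.C β) = MvPowerSeries.C β := by simp [Ψ]
  have hden : Φ (ratioDen k (n + 1)) = (∏ i : Fin n, MvPowerSeries.X i) * Ψ (ratioDen k n) := by
    have e : ∀ m, ratioDen k m = ∏ i : Fin m, ∏ j : Fin m,
        if i < j then (MvPolynomial.X i - MvPolynomial.X j : MvPolynomial (Fin m) k) else 1 := by
      intro m
      refine Finset.prod_congr rfl fun i _ => ?_
      rw [← Finset.prod_filter]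
      congr 1
      ext j
      simp
    rw [e, e, Fin.prod_univ_castSucc]
    have h1 : (∏ j : Fin (n + 1), if Fin.last n < j then
        (MvPolynomial.X (Fin.last n) - MvPolynomial.X j : MvPolynomial (Fin (n + 1)) k) else 1)
          = 1 :=
      Finset.prod_eq_one fun j _ => by simp [not_lt.2 (Fin.le_last j)]
    rw [h1, mul_one, map_prod, map_prod, ← Finset.prod_mul_distrib]
    refine Finset.prod_congr rfl fun i _ => ?_
    rw [Fin.prod_univ_castSucc, map_mul, map_prod, map_prod, mul_comm]
    congr 1
    · simp [Fin.castSucc_lt_last, ΦX, ΦXl]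
    · refine Finset.prod_congr rfl fun j _ => ?_
      by_cases hij : i < j
      · simp [hij, ΦX, ΨX]
      · simp [hij]
  have hnum : Φ (ratioNum β lam (n + 1)) =
      (∏ i : Fin n, MvPowerSeries.X i) * Ψ (ratioNum β lam n) := by
    unfold ratioNum
    rw [RingHom.map_det, RingHom.map_det, ← Matrix.det_mul_column,
      Matrix.det_succ_row _ (Fin.last n), Fin.sum_univ_castSucc, Finset.sum_eq_zero, zero_add]
    · have hs : ((-1 : MvPowerSeries (Fin n) k) ^ ((Fin.last n : ℕ) + (Fin.last n : ℕ))) = 1 :=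
        Even.neg_one_pow ⟨_, rfl⟩
      rw [hs]
      simp only [RingHom.mapMatrix_apply, Matrix.map_apply, Matrix.of_apply, Fin.val_last, h,
        map_mul, map_pow, map_add, map_one, ΦXl]
      simp only [Nat.add_sub_cancel, Nat.sub_self, add_zero, pow_zero, mul_zero, one_pow, one_mul]
      congr 1
      ext1 i j
      simp only [Matrix.submatrix_apply, Matrix.map_apply, Matrix.of_apply, Fin.succAbove_last,
        map_mul, map_pow, map_add, map_one, ΦX, ΦC, ΨX, ΨC, Fin.val_castSucc]
      rw [← mul_assoc, ← pow_succ']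
      congr 2
      have := j.2
      omega
    · intro j _
      have h0 : lam (j : ℕ) + (n - (j : ℕ)) ≠ 0 := by have := j.2; omega
      have hz : (RingHom.mapMatrix Φ (Matrix.of fun i j : Fin (n + 1) =>
          (MvPolynomial.X i : MvPolynomial (Fin (n + 1)) k) ^
            (lam (j : ℕ) + (n + 1 - 1 - (j : ℕ))) *
            (1 + MvPolynomial.C β * MvPolynomial.X i) ^ (j : ℕ))) (Fin.last n) j.castSucc = 0 := by
        simp only [RingHom.mapMatrix_apply, Matrix.map_apply, Matrix.of_apply, map_mul, map_pow,
          ΦXl, Fin.val_castSucc, Nat.add_sub_cancel]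
        rw [zero_pow h0, zero_mul]
      rw [hz, mul_zero, zero_mul]
  have key : Φ (grothendieckPoly β lam (n + 1)) * ((∏ i : Fin n, MvPowerSeries.X i) *
      Ψ (ratioDen k n)) = Ψ (grothendieckPoly β lam n) *
        ((∏ i : Fin n, MvPowerSeries.X i) * Ψ (ratioDen k n)) := by
    rw [mul_left_comm (Ψ (grothendieckPoly β lam n)), ← map_mul Ψ, ← hden, ← map_mul,
      grothendieckPoly_mul_ratioDen, grothendieckPoly_mul_ratioDen, hnum]
  refine mul_right_cancel₀ ?_ key
  refine mul_ne_zero (Finset.prod_ne_zero_iff.2 fun i _ => ?_) ?_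
  · rw [← MvPolynomial.coe_X, Ne, MvPolynomial.coe_eq_zero_iff]
    exact MvPolynomial.X_ne_zero i
  · simpa [Ψ] using ratioDen_ne_zero (k := k) n

/-- There is exactly one series `F` in `x_1, x_2, …` with
`F(x_1, …, x_n, 0, 0, …) = G_λ(x_1, …, x_n)` for all `n ≥ ℓ(λ)`. -/
theorem existsUnique_stable (β : k) (μ : YoungDiagram) :
    ∃! F : MvPowerSeries ℕ k, ∀ n, μ.colLen 0 ≤ n →
      restrictVars n F = (grothendieckPoly β μ.rowLen n : MvPowerSeries (Fin n) k) := by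
  classical
  let c : ∀ n, (Fin n →₀ ℕ) → k := fun n e =>
    MvPowerSeries.coeff e (grothendieckPoly β μ.rowLen n : MvPowerSeries (Fin n) k)
  let res : ∀ n, (ℕ →₀ ℕ) → (Fin n →₀ ℕ) := fun n d =>
    d.comapDomain Fin.val Fin.val_injective.injOn
  have hres : ∀ n (e : Fin n →₀ ℕ), res n (Finsupp.embDomain Fin.valEmbedding e) = e := by
    intro n e
    ext i
    exact Finsupp.embDomain_apply_self Fin.valEmbedding e i
  have hemb : ∀ n (d : ℕ →₀ ℕ), (∀ i ∈ d.support, i < n) →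
      Finsupp.embDomain Fin.valEmbedding (res n d) = d := by
    intro n d hd
    ext i
    by_cases hi : i < n
    · exact Finsupp.embDomain_apply_self Fin.valEmbedding (res n d) ⟨i, hi⟩
    · rw [Finsupp.embDomain_of_notMem_range]
      · by_contra h0
        exact hi (hd i (Finsupp.mem_support_iff.2 (Ne.symm h0)))
      · rintro ⟨j, rfl⟩
        exact hi j.2
  have hstep : ∀ n d, μ.colLen 0 ≤ n → (∀ i ∈ d.support, i < n) →
      c (n + 1) (res (n + 1) d) = c n (res n d) := by
    intro n d hn hd
    have h0 : μ.rowLen n = 0 := by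
      by_contra h
      have hm : (n, 0) ∈ μ := YoungDiagram.mem_iff_lt_rowLen.2 (Nat.pos_of_ne_zero h)
      exact absurd (YoungDiagram.mem_iff_lt_colLen.1 hm) (not_lt.2 hn)
    have hs := congrArg (MvPowerSeries.coeff (res n d)) (stability β μ.rowLen n h0)
    rw [MvPowerSeries.coeff_killCompl] at hs
    have : Finsupp.embDomain Fin.castSuccEmb (res n d) = res (n + 1) d := by
      apply Finsupp.embDomain_injective Fin.valEmbedding
      rw [hemb (n + 1) d fun i hi => (hd i hi).trans (Nat.lt_succ_self n)]
      conv_rhs => rw [← hemb n d hd]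
      rw [← Finsupp.embDomain_trans_apply]
      rfl
    rw [this] at hs
    exact hs
  let b : (ℕ →₀ ℕ) → ℕ := fun d => max (μ.colLen 0) (d.support.sup id + 1)
  have hb : ∀ d : ℕ →₀ ℕ, ∀ i ∈ d.support, i < b d := by
    intro d i hi
    have : i ≤ d.support.sup id := Finset.le_sup (f := id) hi
    simp only [b]
    omega
  have hstab : ∀ d n m, μ.colLen 0 ≤ n → (∀ i ∈ d.support, i < n) → n ≤ m →
      c m (res m d) = c n (res n d) := by
    intro d n m hn hd hnm
    induction m, hnm using Nat.le_induction with
    | base => rfl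
    | succ m hm ih =>
      rw [← ih]
      exact hstep m d (hn.trans hm) fun i hi => (hd i hi).trans_le hm
  refine ⟨fun d => c (b d) (res (b d) d), ?_, ?_⟩
  · intro n hn
    ext e
    change c _ (res _ (Finsupp.embDomain Fin.valEmbedding e)) = c n e
    set d := Finsupp.embDomain Fin.valEmbedding e with hdef
    have hd : ∀ i ∈ d.support, i < n := by
      intro i hi
      rw [hdef, Finsupp.support_embDomain, Finset.mem_map] at hi
      obtain ⟨j, _, rfl⟩ := hi
      exact j.2
    have e1 := hstab d (b d) (max n (b d)) (le_max_left _ _) (hb d) (le_max_right _ _)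
    have e2 := hstab d n (max n (b d)) hn hd (le_max_left _ _)
    rw [← e1, e2, hdef, hres]
  · intro F hF
    ext d
    have := congrArg (MvPowerSeries.coeff (res (b d) d)) (hF (b d) (le_max_left _ _))
    unfold restrictVars at this
    rw [MvPowerSeries.coeff_killCompl, hemb _ _ (hb d)] at this
    exact this

/-- The stable Grothendieck polynomial `G_λ(x)` in the variables `x_1, x_2, …`, for the partition
with parts `μ.rowLen 0 ≥ μ.rowLen 1 ≥ ⋯` and length `μ.colLen 0`: the unique series that
specializes to `G_λ(x_1, …, x_n)` for all `n ≥ ℓ(λ)`. -/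
noncomputable def stableGrothendieck (β : k) (μ : YoungDiagram) : MvPowerSeries ℕ k :=
  (existsUnique_stable β μ).choose

theorem restrictVars_stableGrothendieck (β : k) (μ : YoungDiagram) (n : ℕ)
    (hn : μ.colLen 0 ≤ n) :
    restrictVars n (stableGrothendieck β μ) =
      (grothendieckPoly β μ.rowLen n : MvPowerSeries (Fin n) k) :=
  (existsUnique_stable β μ).choose_spec.1 n hn

/-- The functions `G_n(x)`, `n ∈ ℤ`: the stable Grothendieck polynomial of the one-row partition
`(n)` for `n ≥ 0` (the empty partition for `n = 0`), and the constant `(-β) ^ (-n)` for `n < 0`. -/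
noncomputable def oneRow (β : k) : ℤ → MvPowerSeries ℕ k
  | Int.ofNat n => stableGrothendieck β (YoungDiagram.ofRowLens [n] (List.pairwise_singleton _ n).sortedGE)
  | Int.negSucc n => MvPowerSeries.C ((-β) ^ (n + 1))

/-- The factor `(1 + β x_i) / (1 - x_i z)`, as a power series in `z` over `k⟦x_1, x_2, …⟧`. -/
noncomputable def genFactor (β : k) (i : ℕ) : PowerSeries (MvPowerSeries ℕ k) :=
  PowerSeries.C (1 + MvPowerSeries.C β * MvPowerSeries.X i) *
    PowerSeries.invOfUnit (1 - PowerSeries.C (MvPowerSeries.X i) * PowerSeries.X) 1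

theorem genFactor_mul (β : k) (i : ℕ) :
    genFactor β i * (1 - PowerSeries.C (MvPowerSeries.X i) * PowerSeries.X) =
      PowerSeries.C (1 + MvPowerSeries.C β * MvPowerSeries.X i) := by
  rw [genFactor, mul_assoc, PowerSeries.invOfUnit_mul _ _ (by simp), mul_one]

/-- The coefficient of `z ^ n` in a power series in `z`, which is zero for `n < 0`. -/
noncomputable def zCoeff {R : Type*} [CommRing R] (f : PowerSeries R) (n : ℤ) : R :=
  if 0 ≤ n then PowerSeries.coeff n.toNat f else 0

/-- The `m`-th term `binom(i - r, m) β ^ m G_{λ_i - i + j + m}(x)` of the entry in row `i`, column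
`j`; rows and columns are numbered from `0`, so that `i - r` becomes `i + 1 - r`. -/
noncomputable def detTerm (β : k) (μ : YoungDiagram) (r : ℕ) (i j : Fin r) (m : ℕ) :
    MvPowerSeries ℕ k :=
  (((Ring.choose (((i : ℕ) : ℤ) + 1 - (r : ℤ)) m : ℤ) : k) * β ^ m) •
    oneRow β ((μ.rowLen i : ℤ) - ((i : ℕ) : ℤ) + ((j : ℕ) : ℤ) + (m : ℤ))

end StableGrothendieck

/-! Let `S` be the shift `(S F)_n = F_{n+1}` on families of power series whose coefficients each
vanish for large `n`. Every power series in `S` acts on such families (`shiftSum`), and products act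
by composition (`shiftSum_mul`). The entries of the determinant in (2) are `(1 + β S)^(i - r) G`
evaluated at `λ_i - i + j`, with rows numbered from `1`.

In `N` variables let `h_n` be the complete symmetric polynomials and put `G = ∏ (1 + β x_l) · (1 + β
S)⁻¹ h`. For `r = N` the entries become `∏ (1 + β x_l) · (1 + β S)^(i - 1 - N) h`. As in the
classical proof of Jacobi–Trudi, multiplication by a matrix of signed elementary symmetric
polynomials turns `h_n` into `x_l^n`, on which `1 + β S` acts as `1 + β x_l` for `n ≥ 0`. This
yields the numerator of the ratio formula, while that matrix has the denominator as its determinant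
(`det_shiftSum_complete`).

Since `G_{-n} = (-β)^n` (`finiteOneRow_neg`), a zero part at the bottom of `λ` can be removed by a
column operation, so `r` can be lowered from `N` to any bound on the length (`det_shiftSum_succ`).
The case `r = 1` identifies `G_n` with the one-row Grothendieck polynomial, which is (1) in finitely
many variables. Identities and convergence then lift to infinitely many variables, because each
coefficient is seen after setting all but finitely many variables to zero
(`exists_coeff_eq_coeff_restrictHom`). -/

namespace StableGrothendieck

/-! ### Integer powers of `1 + β X`. -/

/-- The power series `(1 + β X) ^ a` for an integer `a`. -/
noncomputable def oneAddPow {k : Type*} [Field k] (β : k) (a : ℤ) : PowerSeries k :=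
  PowerSeries.rescale β (PowerSeries.binomialSeries k a)

section OneAddPow

variable {k : Type*} [Field k]

theorem coeff_oneAddPow (β : k) (a : ℤ) (m : ℕ) :
    PowerSeries.coeff m (oneAddPow β a) = ((Ring.choose a m : ℤ) : k) * β ^ m := by
  simp [oneAddPow, PowerSeries.coeff_rescale, mul_comm]

theorem oneAddPow_add (β : k) (a b : ℤ) :
    oneAddPow β (a + b) = oneAddPow β a * oneAddPow β b := by
  simp [oneAddPow]

theorem oneAddPow_zero (β : k) : oneAddPow β 0 = 1 := by
  simp [oneAddPow]

theorem coeff_oneAddPow_neg_one (β : k) (m : ℕ) :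
    PowerSeries.coeff m (oneAddPow β (-1)) = (-β) ^ m := by
  have h : Ring.choose (-1 : ℤ) m = (-1) ^ m := by
    rw [Ring.choose_neg, show (1 : ℤ) + m - 1 = (m : ℕ) by ring, Ring.choose_natCast,
      Nat.choose_self]
    simp [Units.smul_def, Int.coe_negOnePow_natCast]
  rw [coeff_oneAddPow, h, neg_pow β]
  simp

end OneAddPow

/-! ### Power series in the shift operator, and lowering the size of the determinant. -/

section Shift

variable {σ k : Type*} [Field k]

/-- Every coefficient of `F n` vanishes for all large `n`. -/
def VanishesAtTop (F : ℤ → MvPowerSeries σ k) : Prop :=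
  ∀ d : σ →₀ ℕ, ∃ B : ℤ, ∀ n, B ≤ n → MvPowerSeries.coeff d (F n) = 0

theorem VanishesAtTop.exists_nat {F : ℤ → MvPowerSeries σ k} (hF : VanishesAtTop F)
    (d : σ →₀ ℕ) (n : ℤ) :
    ∃ K : ℕ, ∀ m : ℕ, K ≤ m → MvPowerSeries.coeff d (F (n + m)) = 0 := by
  obtain ⟨B, hB⟩ := hF d
  exact ⟨(B - n).toNat, fun m hm => hB _ (by omega)⟩

theorem VanishesAtTop.const_mul {F : ℤ → MvPowerSeries σ k} (hF : VanishesAtTop F)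
    (P : MvPowerSeries σ k) : VanishesAtTop fun n => P * F n := by
  classical
  intro d
  choose B hB using hF
  obtain ⟨M, hM⟩ := ((Finset.HasAntidiagonal.antidiagonal d).image fun p => B p.2).exists_le
  refine ⟨M, fun n hn => ?_⟩
  rw [MvPowerSeries.coeff_mul]
  refine Finset.sum_eq_zero fun p hp => ?_
  rw [hB p.2 n ((hM _ (Finset.mem_image_of_mem _ hp)).trans hn), mul_zero]

variable [TopologicalSpace k]

/-- The action of a power series `f(S)` in the shift operator `S F = F (· + 1)`. -/
noncomputable def shiftSum (f : PowerSeries k) (F : ℤ → MvPowerSeries σ k) (n : ℤ) :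
    MvPowerSeries σ k :=
  ∑' m : ℕ, PowerSeries.coeff m f • F (n + m)

theorem summable_smul_shift (c : ℕ → k) {F : ℤ → MvPowerSeries σ k} (hF : VanishesAtTop F)
    (n : ℤ) : Summable fun m : ℕ => c m • F (n + m) := by
  rw [MvPowerSeries.WithPiTopology.summable_iff_summable_coeff]
  intro d
  obtain ⟨K, hK⟩ := hF.exists_nat d n
  refine summable_of_ne_finset_zero (s := Finset.range K) fun m hm => ?_
  rw [MvPowerSeries.coeff_smul, hK m (by simpa using hm), mul_zero]

theorem shiftSum_oneAddPow_one (β : k) (F : ℤ → MvPowerSeries σ k) (n : ℤ) :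
    shiftSum (oneAddPow β 1) F n = F n + β • F (n + 1) := by
  unfold shiftSum
  have hc : ∀ m : ℕ, PowerSeries.coeff m (oneAddPow β 1) = ((Nat.choose 1 m : ℕ) : k) * β ^ m := by
    intro m
    rw [coeff_oneAddPow, ← Nat.cast_one (R := ℤ), Ring.choose_natCast]
    simp
  rw [tsum_eq_sum (s := Finset.range 2)]
  · simp [hc, Finset.sum_range_succ]
  · intro m hm
    rw [hc, Nat.choose_eq_zero_of_lt (by simpa using hm)]
    simp

theorem shiftSum_one {F : ℤ → MvPowerSeries σ k} : shiftSum 1 F = F := by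
  funext n
  unfold shiftSum
  rw [tsum_eq_single 0]
  · simp
  · intro m hm
    simp [PowerSeries.coeff_one, hm]

theorem shiftSum_oneAddPow_zero (β : k) {F : ℤ → MvPowerSeries σ k} :
    shiftSum (oneAddPow β 0) F = F := by
  rw [oneAddPow_zero, shiftSum_one]

theorem hasSum_shiftSum (f : PowerSeries k) {F : ℤ → MvPowerSeries σ k} (hF : VanishesAtTop F)
    (n : ℤ) : HasSum (fun m : ℕ => PowerSeries.coeff m f • F (n + m)) (shiftSum f F n) :=
  (summable_smul_shift _ hF n).hasSum

variable [DiscreteTopology k]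

theorem coeff_shiftSum (f : PowerSeries k) {F : ℤ → MvPowerSeries σ k} (hF : VanishesAtTop F)
    {n : ℤ} {d : σ →₀ ℕ} {K : ℕ}
    (hK : ∀ m : ℕ, K ≤ m → MvPowerSeries.coeff d (F (n + m)) = 0) :
    MvPowerSeries.coeff d (shiftSum f F n) =
      ∑ m ∈ Finset.range K, PowerSeries.coeff m f * MvPowerSeries.coeff d (F (n + m)) := by
  have h := MvPowerSeries.WithPiTopology.hasSum_iff_hasSum_coeff.1 (hasSum_shiftSum f hF n) d
  refine h.unique ?_
  refine hasSum_sum_of_ne_finset_zero fun m hm => ?_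
  rw [MvPowerSeries.coeff_smul, hK m (by simpa using hm), mul_zero]

theorem VanishesAtTop.shiftSum (f : PowerSeries k) {F : ℤ → MvPowerSeries σ k}
    (hF : VanishesAtTop F) : VanishesAtTop (shiftSum f F) := by
  intro d
  obtain ⟨B, hB⟩ := hF d
  refine ⟨B, fun n hn => ?_⟩
  rw [coeff_shiftSum f hF (K := 0) fun m _ => hB _ (by omega), Finset.range_zero,
    Finset.sum_empty]

theorem shiftSum_mul (f g : PowerSeries k) {F : ℤ → MvPowerSeries σ k} (hF : VanishesAtTop F) :
    shiftSum (f * g) F = shiftSum f (shiftSum g F) := by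
  funext n
  ext d
  obtain ⟨K, hK⟩ := hF.exists_nat d n
  -- Only pairs with `a + b < K` contribute to the coefficient at `d`, so both sides are one finite
  -- sum over a triangle, read by diagonals or by rows.
  have hK' : ∀ a b : ℕ, K - a ≤ b → MvPowerSeries.coeff d (F (n + a + b)) = 0 := by
    intro a b h
    have := hK (a + b) (by omega)
    rwa [Nat.cast_add, ← add_assoc] at this
  rw [coeff_shiftSum _ hF hK, coeff_shiftSum f (hF.shiftSum g) (K := K)]
  · simp_rw [PowerSeries.coeff_mul, Finset.Nat.sum_antidiagonal_eq_sum_range_succ_mk]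
    have := Finset.sum_range_diag_flip K fun a b =>
      PowerSeries.coeff a f * PowerSeries.coeff b g * MvPowerSeries.coeff d (F (n + a + b))
    have e : ∀ a ∈ Finset.range K, PowerSeries.coeff a f *
        MvPowerSeries.coeff d (StableGrothendieck.shiftSum g F (n + a)) =
        ∑ b ∈ Finset.range (K - a), PowerSeries.coeff a f * PowerSeries.coeff b g *
          MvPowerSeries.coeff d (F (n + a + b)) := by
      intro a _
      rw [coeff_shiftSum g hF (hK' a), Finset.mul_sum]
      simp_rw [mul_assoc]
    rw [Finset.sum_congr rfl e, ← this]
    refine Finset.sum_congr rfl fun p hp => ?_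
    rw [Finset.sum_mul]
    refine Finset.sum_congr rfl fun a ha => ?_
    have : (n + a + (p - a : ℕ) : ℤ) = n + p := by
      have := Finset.mem_range.1 ha
      omega
    rw [this]
  · intro a ha
    rw [coeff_shiftSum g hF (K := 0) fun b _ => hK' a b (by omega), Finset.range_zero,
      Finset.sum_empty]

theorem shiftSum_const_mul (f : PowerSeries k) {F : ℤ → MvPowerSeries σ k}
    (hF : VanishesAtTop F) (P : MvPowerSeries σ k) (n : ℤ) :
    shiftSum f (fun n => P * F n) n = P * shiftSum f F n := by
  unfold shiftSum
  rw [← (summable_smul_shift _ hF n).tsum_mul_left]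
  simp_rw [mul_smul_comm]

theorem shiftSum_sum_shift {ι : Type*} (s : Finset ι) (f : PowerSeries k)
    {F : ℤ → MvPowerSeries σ k} (hF : VanishesAtTop F) (c : ι → MvPowerSeries σ k) (e : ι → ℤ)
    (n : ℤ) :
    shiftSum f (fun n => ∑ i ∈ s, c i * F (n + e i)) n =
      ∑ i ∈ s, c i * shiftSum f F (n + e i) := by
  have h : HasSum (fun m : ℕ => ∑ i ∈ s, c i * (PowerSeries.coeff m f • F (n + e i + m)))
      (∑ i ∈ s, c i * shiftSum f F (n + e i)) :=
    hasSum_sum fun i _ => (hasSum_shiftSum f hF _).mul_left _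
  refine HasSum.tsum_eq ?_
  convert h using 2 with m
  rw [Finset.smul_sum]
  refine Finset.sum_congr rfl fun i _ => ?_
  rw [mul_smul_comm, add_right_comm]

theorem shiftSum_oneAddPow_add_one (β : k) (a : ℤ) {F : ℤ → MvPowerSeries σ k}
    (hF : VanishesAtTop F) (n : ℤ) :
    shiftSum (oneAddPow β (a + 1)) F n =
      shiftSum (oneAddPow β a) F n + β • shiftSum (oneAddPow β a) F (n + 1) := by
  rw [add_comm, oneAddPow_add, shiftSum_mul _ _ hF, shiftSum_oneAddPow_one]

/-- The determinants for `r` and `r + 1` agree if `λ_{r+1} = 0`. -/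
theorem det_shiftSum_succ (β : k) {g : ℤ → MvPowerSeries σ k} (hg : VanishesAtTop g)
    (hneg : ∀ n : ℕ, g (-n) = MvPowerSeries.C ((-β) ^ n)) (lam : ℕ → ℕ) (r : ℕ)
    (hr : lam r = 0) :
    Matrix.det (Matrix.of fun i j : Fin (r + 1) =>
      shiftSum (oneAddPow β (((i : ℕ) : ℤ) + 1 - ((r + 1 : ℕ) : ℤ))) g
        ((lam i : ℤ) - ((i : ℕ) : ℤ) + ((j : ℕ) : ℤ))) =
    Matrix.det (Matrix.of fun i j : Fin r =>
      shiftSum (oneAddPow β (((i : ℕ) : ℤ) + 1 - (r : ℤ))) g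
        ((lam i : ℤ) - ((i : ℕ) : ℤ) + ((j : ℕ) : ℤ))) := by
  set M : Matrix (Fin (r + 1)) (Fin (r + 1)) (MvPowerSeries σ k) := Matrix.of fun i j =>
      shiftSum (oneAddPow β (((i : ℕ) : ℤ) + 1 - ((r + 1 : ℕ) : ℤ))) g
        ((lam i : ℤ) - ((i : ℕ) : ℤ) + ((j : ℕ) : ℤ)) with hM
  -- Right multiplication by `U` adds `β` times column `j + 1` to column `j`. The last row `(-β)^(r
  -- - j)` becomes `(0, …, 0, 1)`; in every other row one more factor `1 + β S` is applied, which
  -- raises the exponent `i - r` to `i + 1 - r`.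
  let U : Matrix (Fin (r + 1)) (Fin (r + 1)) (MvPowerSeries σ k) := Matrix.of fun l j =>
    (if l = j then 1 else 0) + if (l : ℕ) = j + 1 then MvPowerSeries.C β else 0
  have hU : U.det = 1 := by
    rw [Matrix.det_of_isLowerTriangular]
    · simp [U]
    · intro l j hlj
      have h : l < j := hlj
      have h1 : (l : ℕ) ≠ j + 1 := by have : (l : ℕ) < j := h; omega
      simp [U, h.ne, h1]
  have hlast : ∀ i, (M * U) i (Fin.last r) = M i (Fin.last r) := by
    intro i
    rw [Matrix.mul_apply, Finset.sum_eq_single (Fin.last r)]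
    · simp [U]
    · intro l _ hl
      have : (l : ℕ) ≠ r + 1 := by omega
      simp [U, hl, this]
    · simp
  have hcast : ∀ i (j : Fin r), (M * U) i j.castSucc =
      M i j.castSucc + MvPowerSeries.C β * M i j.succ := by
    intro i j
    have : ∀ l : Fin (r + 1), ((l : ℕ) = j + 1) = (l = j.succ) := fun l => by
      simp [Fin.ext_iff]
    rw [mul_comm (MvPowerSeries.C β)]
    simp [Matrix.mul_apply, U, mul_add, Finset.sum_add_distrib, this]
  have hrow : ∀ j, M (Fin.last r) j = MvPowerSeries.C ((-β) ^ (r - (j : ℕ))) := by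
    intro j
    rw [← hneg, hM, Matrix.of_apply]
    -- The exponent is zero in the last row, so its entries are plain values of `g` at the indices
    -- `j - r ≤ 0`.
    have h1 : (((Fin.last r : Fin (r + 1)) : ℕ) : ℤ) + 1 - ((r + 1 : ℕ) : ℤ) = 0 := by simp
    rw [h1, shiftSum_oneAddPow_zero]
    congr 1
    have := j.is_le
    simp only [Fin.val_last, hr]
    omega
  rw [← mul_one M.det, ← hU, ← Matrix.det_mul, Matrix.det_succ_row _ (Fin.last r),
    Fin.sum_univ_castSucc, Finset.sum_eq_zero, zero_add]
  · rw [hlast, hrow]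
    have hs : ((-1 : MvPowerSeries σ k) ^ ((Fin.last r : ℕ) + (Fin.last r : ℕ))) = 1 :=
      Even.neg_one_pow ⟨_, rfl⟩
    rw [hs]
    simp only [Fin.val_last, Nat.sub_self, pow_zero, map_one, one_mul]
    congr 1
    ext1 i j
    rw [Matrix.submatrix_apply, Fin.succAbove_last, hcast, Matrix.of_apply, hM, Matrix.of_apply,
      Matrix.of_apply]
    have e : (((i : ℕ) : ℤ) + 1 - (r : ℤ)) =
      ((((i.castSucc : Fin (r + 1)) : ℕ) : ℤ) + 1 - ((r + 1 : ℕ) : ℤ)) + 1 := by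
      push_cast [Fin.val_castSucc]
      ring
    rw [e, shiftSum_oneAddPow_add_one _ _ hg, MvPowerSeries.smul_eq_C_mul]
    simp only [Fin.val_castSucc, Fin.val_succ]
    push_cast
    simp only [add_assoc]
  · intro j _
    rw [hcast, hrow, hrow, ← map_mul, ← map_add]
    have : r - (j : ℕ) = (r - (j + 1 : ℕ)) + 1 := by have := j.2; omega
    simp only [Fin.val_castSucc, Fin.val_succ]
    rw [this, pow_succ]
    ring_nf
    simp

theorem det_shiftSum_eq (β : k) {g : ℤ → MvPowerSeries σ k} (hg : VanishesAtTop g)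
    (hneg : ∀ n : ℕ, g (-n) = MvPowerSeries.C ((-β) ^ n)) (lam : ℕ → ℕ) {r N : ℕ}
    (hrN : r ≤ N) (hr : ∀ i, r ≤ i → lam i = 0) :
    Matrix.det (Matrix.of fun i j : Fin N =>
      shiftSum (oneAddPow β (((i : ℕ) : ℤ) + 1 - (N : ℤ))) g
        ((lam i : ℤ) - ((i : ℕ) : ℤ) + ((j : ℕ) : ℤ))) =
    Matrix.det (Matrix.of fun i j : Fin r =>
      shiftSum (oneAddPow β (((i : ℕ) : ℤ) + 1 - (r : ℤ))) g
        ((lam i : ℤ) - ((i : ℕ) : ℤ) + ((j : ℕ) : ℤ))) := by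
  induction N, hrN using Nat.le_induction with
  | base => rfl
  | succ N hN ih => rw [← ih, det_shiftSum_succ β hg hneg lam N (hr N hN)]

end Shift
-- Coefficients in `z` as families indexed by the integers.
section ZCoeff

variable {R : Type*} [CommRing R]

theorem zCoeff_natCast (f : PowerSeries R) (n : ℕ) : zCoeff f n = PowerSeries.coeff n f := by
  simp [zCoeff]

theorem zCoeff_of_neg (f : PowerSeries R) {n : ℤ} (hn : n < 0) : zCoeff f n = 0 := by
  simp [zCoeff, hn]

theorem zCoeff_C_mul (a : R) (f : PowerSeries R) (n : ℤ) :
    zCoeff (PowerSeries.C a * f) n = a * zCoeff f n := by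
  unfold zCoeff
  split_ifs <;> simp

/-- The summation range does not depend on `n`, so multiplication by a polynomial in `z` is a fixed
linear combination of shifts and commutes with `shiftSum`. -/
theorem zCoeff_mul {Q : PowerSeries R} {K : ℕ} (hQ : ∀ q, K ≤ q → PowerSeries.coeff q Q = 0)
    (f : PowerSeries R) (n : ℤ) :
    zCoeff (Q * f) n = ∑ q ∈ Finset.range K, PowerSeries.coeff q Q * zCoeff f (n - q) := by
  obtain hn | hn := lt_or_ge n 0
  · rw [zCoeff_of_neg _ hn, Finset.sum_eq_zero fun q _ => ?_]
    rw [zCoeff_of_neg _ (by omega), mul_zero]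
  · lift n to ℕ using hn
    rw [zCoeff_natCast, PowerSeries.coeff_mul, Finset.Nat.sum_antidiagonal_eq_sum_range_succ_mk]
    have h1 : ∑ q ∈ Finset.range n.succ, PowerSeries.coeff q Q * PowerSeries.coeff (n - q) f =
        ∑ q ∈ Finset.range n.succ, PowerSeries.coeff q Q * zCoeff f (n - q) := by
      refine Finset.sum_congr rfl fun q hq => ?_
      rw [← Nat.cast_sub (by simpa [Nat.lt_succ_iff] using hq), zCoeff_natCast]
    rw [h1, Finset.sum_subset (Finset.range_mono (le_max_left n.succ K)),
      Finset.sum_subset (Finset.range_mono (le_max_right n.succ K))]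
    · intro q _ hq
      rw [hQ q (by simpa using hq), zero_mul]
    · intro q _ hq
      have : n.succ ≤ q := by simpa using hq
      rw [zCoeff_of_neg f (by omega), mul_zero]

/-- The geometric series `1 / (1 - x z)`. -/
def geomSeries (x : R) : PowerSeries R := PowerSeries.mk fun p => x ^ p

theorem geomSeries_mul (x : R) :
    geomSeries x * (1 - PowerSeries.C x * PowerSeries.X) = 1 := by
  ext (_ | p)
  · simp [geomSeries]
  · rw [mul_sub, mul_one, mul_left_comm, map_sub, PowerSeries.coeff_C_mul,
      PowerSeries.coeff_succ_mul_X]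
    simp [geomSeries, PowerSeries.coeff_one, pow_succ']

end ZCoeff

/-! ### Jacobi–Trudi in finitely many variables. -/

section Finite

variable {k : Type*} [Field k]

theorem vanishesAtTop_zCoeff {σ : Type*} {f : PowerSeries (MvPowerSeries σ k)}
    (hf : ∀ (d : σ →₀ ℕ) (p : ℕ), d.degree < p →
      MvPowerSeries.coeff d (PowerSeries.coeff p f) = 0) :
    VanishesAtTop (zCoeff f) := by
  intro d
  refine ⟨(d.degree + 1 : ℕ), fun n hn => ?_⟩
  lift n to ℕ using by omega
  rw [zCoeff_natCast]
  exact hf d n (by omega)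

theorem coeff_coeff_geomSeries_X {σ : Type*} (l : σ) (d : σ →₀ ℕ) (p : ℕ) (h : d.degree < p) :
    MvPowerSeries.coeff d (PowerSeries.coeff p (geomSeries (MvPowerSeries.X l : MvPowerSeries σ k)))
      = 0 := by
  classical
  rw [geomSeries, PowerSeries.coeff_mk, MvPowerSeries.coeff_X_pow, if_neg]
  rintro rfl
  simp at h

/-- The coefficient of `z^p` is homogeneous of degree `p` in the variables. This is what makes the
families `h_n` and `x_l^n` vanish at the top. -/
theorem coeff_coeff_prod_geomSeries_X {σ : Type*} (s : Finset σ) (d : σ →₀ ℕ) (p : ℕ)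
    (h : d.degree < p) :
    MvPowerSeries.coeff d (PowerSeries.coeff p
      (∏ l ∈ s, geomSeries (MvPowerSeries.X l : MvPowerSeries σ k))) = 0 := by
  classical
  induction s using Finset.induction_on generalizing d p with
  | empty => simp [PowerSeries.coeff_one, (Nat.zero_le _).trans_lt h |>.ne']
  | insert l s hl ih =>
    rw [Finset.prod_insert hl, PowerSeries.coeff_mul, map_sum]
    refine Finset.sum_eq_zero fun q hq => ?_
    rw [MvPowerSeries.coeff_mul]
    refine Finset.sum_eq_zero fun e he => ?_
    rw [Finset.HasAntidiagonal.mem_antidiagonal] at hq he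
    have hdeg : e.1.degree + e.2.degree = d.degree := by rw [← he, map_add]
    obtain h1 | h1 := lt_or_ge e.1.degree q.1
    · rw [coeff_coeff_geomSeries_X l _ _ h1, zero_mul]
    · rw [ih _ _ (by omega), mul_zero]

variable (k) in
/-- The generating series `∏_l 1 / (1 - x_l z)` of the complete symmetric polynomials. -/
noncomputable def completeSeries (N : ℕ) : PowerSeries (MvPowerSeries (Fin N) k) :=
  ∏ l, geomSeries (MvPowerSeries.X l)

variable (k) in
/-- The complete symmetric polynomials `h_n(x_1, …, x_N)`, zero for `n < 0`. -/
noncomputable def complete (N : ℕ) : ℤ → MvPowerSeries (Fin N) k :=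
  zCoeff (completeSeries k N)

variable (k) in
/-- The polynomial `∏_{i ∈ s} (1 - x_i z)`. -/
noncomputable def elemPoly {N : ℕ} (s : Finset (Fin N)) : Polynomial (MvPowerSeries (Fin N) k) :=
  ∏ i ∈ s, (1 - Polynomial.C (MvPowerSeries.X i) * Polynomial.X)

/-- The powers `x_l ^ n`, extended by zero to `n < 0`. -/
noncomputable def varPow {N : ℕ} (l : Fin N) : ℤ → MvPowerSeries (Fin N) k :=
  zCoeff (geomSeries (MvPowerSeries.X l))

theorem vanishesAtTop_complete (N : ℕ) : VanishesAtTop (complete k N) :=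
  vanishesAtTop_zCoeff fun d p h => coeff_coeff_prod_geomSeries_X _ d p h

theorem vanishesAtTop_varPow {N : ℕ} (l : Fin N) : VanishesAtTop (varPow (k := k) l) :=
  vanishesAtTop_zCoeff fun d p h => coeff_coeff_geomSeries_X l d p h

theorem complete_zero (N : ℕ) : complete k N 0 = 1 := by
  rw [complete, ← Nat.cast_zero, zCoeff_natCast, PowerSeries.coeff_zero_eq_constantCoeff_apply,
    completeSeries, map_prod]
  refine Finset.prod_eq_one fun l _ => ?_
  rw [← PowerSeries.coeff_zero_eq_constantCoeff_apply]
  simp [geomSeries]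

theorem complete_of_neg (N : ℕ) {n : ℤ} (hn : n < 0) : complete k N n = 0 :=
  zCoeff_of_neg _ hn

theorem varPow_natCast {N : ℕ} (l : Fin N) (n : ℕ) :
    varPow (k := k) l n = MvPowerSeries.X l ^ n := by
  rw [varPow, zCoeff_natCast, geomSeries, PowerSeries.coeff_mk]

theorem coe_elemPoly {N : ℕ} (s : Finset (Fin N)) :
    (elemPoly k s : PowerSeries (MvPowerSeries (Fin N) k)) =
      ∏ i ∈ s, (1 - PowerSeries.C (MvPowerSeries.X i) * PowerSeries.X) := by
  rw [elemPoly, ← Polynomial.coeToPowerSeries.ringHom_apply, map_prod]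
  simp

theorem coeff_elemPoly {N : ℕ} (s : Finset (Fin N)) (q : ℕ) (hq : s.card < q) :
    (elemPoly k s).coeff q = 0 := by
  refine Polynomial.coeff_eq_zero_of_natDegree_lt (lt_of_le_of_lt ?_ hq)
  refine (Polynomial.natDegree_prod_le _ _).trans ?_
  rw [Finset.card_eq_sum_ones]
  refine Finset.sum_le_sum fun i _ => ?_
  compute_degree

theorem elemPoly_mul_completeSeries (N : ℕ) :
    (elemPoly k (Finset.univ : Finset (Fin N)) : PowerSeries (MvPowerSeries (Fin N) k)) *
      completeSeries k N = 1 := by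
  rw [coe_elemPoly, completeSeries, ← Finset.prod_mul_distrib]
  exact Finset.prod_eq_one fun i _ => by rw [mul_comm, geomSeries_mul]

theorem elemPoly_erase_mul_completeSeries {N : ℕ} (l : Fin N) :
    (elemPoly k (Finset.univ.erase l) : PowerSeries (MvPowerSeries (Fin N) k)) *
      completeSeries k N = geomSeries (MvPowerSeries.X l) := by
  rw [coe_elemPoly, completeSeries, ← Finset.prod_erase_mul _ _ (Finset.mem_univ l), ← mul_assoc,
    ← Finset.prod_mul_distrib, Finset.prod_eq_one fun i _ => by rw [mul_comm, geomSeries_mul],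
    one_mul]

/-- Compare coefficients in `1 / (1 - x_l z) = ∏_{i ≠ l} (1 - x_i z) · ∏_i 1 / (1 - x_i z)`; the
first factor has degree at most `N - 1`. The sum is reversed so that `i` matches the column index of
the determinant. -/
theorem varPow_eq_sum {N : ℕ} (l : Fin N) (n : ℤ) :
    varPow (k := k) l n = ∑ i : Fin N, (elemPoly k (Finset.univ.erase l)).coeff (N - 1 - (i : ℕ)) *
      complete k N (n + (((i : ℕ) : ℤ) - ((N : ℤ) - 1))) := by
  have hN := l.pos
  rw [varPow, ← elemPoly_erase_mul_completeSeries, zCoeff_mul (K := N), ← Finset.sum_range_reflect,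
    Finset.sum_range]
  · refine Finset.sum_congr rfl fun i _ => ?_
    have := i.2
    rw [Polynomial.coeff_coe, complete]
    congr 2
    omega
  · intro q hq
    rw [Polynomial.coeff_coe, coeff_elemPoly]
    rw [Finset.card_erase_of_mem (Finset.mem_univ l), Finset.card_univ, Fintype.card_fin]
    omega

theorem det_X_pow (N : ℕ) :
    Matrix.det (Matrix.of fun j l : Fin N =>
      (MvPowerSeries.X l : MvPowerSeries (Fin N) k) ^ (N - 1 - (j : ℕ))) =
      (ratioDen k N : MvPowerSeries (Fin N) k) := by
  have h := Matrix.det_projVandermonde (1 : Fin N → MvPowerSeries (Fin N) k) MvPowerSeries.X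
  rw [← Matrix.det_transpose]
  convert h using 1
  · congr 1
    ext1 l j
    rw [Matrix.transpose_apply, Matrix.of_apply, Matrix.projVandermonde_apply, Fin.val_rev,
      Pi.one_apply, one_pow, one_mul]
    congr 1
    omega
  · rw [ratioDen, ← MvPolynomial.coeToMvPowerSeries.ringHom_apply]
    simp only [map_prod, map_sub, MvPolynomial.coeToMvPowerSeries.ringHom_apply,
      MvPolynomial.coe_X, Pi.one_apply, one_mul]

/-- The product `∏_l (1 + β x_l)`. -/
noncomputable def oneAddProd (β : k) (N : ℕ) : MvPowerSeries (Fin N) k :=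
  ∏ l, (1 + MvPowerSeries.C β * MvPowerSeries.X l)

theorem coe_ratioNum (β : k) (lam : ℕ → ℕ) (N : ℕ) :
    (ratioNum β lam N : MvPowerSeries (Fin N) k) = Matrix.det (Matrix.of fun j l : Fin N =>
      MvPowerSeries.X l ^ (lam j + (N - 1 - (j : ℕ))) *
        (1 + MvPowerSeries.C β * MvPowerSeries.X l : MvPowerSeries (Fin N) k) ^ (j : ℕ)) := by
  rw [ratioNum, ← MvPolynomial.coeToMvPowerSeries.ringHom_apply, RingHom.map_det,
    ← Matrix.det_transpose]
  congr 1
  ext1 j l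
  simp

variable (k) in
/-- The signed elementary symmetric polynomials in all the variables but `x_l`. -/
noncomputable def elemMatrix (N : ℕ) : Matrix (Fin N) (Fin N) (MvPowerSeries (Fin N) k) :=
  Matrix.of fun i l => (elemPoly k (Finset.univ.erase l)).coeff (N - 1 - (i : ℕ))

section Det

variable [TopologicalSpace k] [DiscreteTopology k]

theorem shiftSum_varPow_eq_sum {N : ℕ} (l : Fin N) (f : PowerSeries k) (n : ℤ) :
    shiftSum f (varPow l) n =
      ∑ i : Fin N, (elemPoly k (Finset.univ.erase l)).coeff (N - 1 - (i : ℕ)) *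
        shiftSum f (complete k N) (n + (((i : ℕ) : ℤ) - ((N : ℤ) - 1))) := by
  have h : varPow (k := k) l = fun n => ∑ i ∈ (Finset.univ : Finset (Fin N)),
      (elemPoly k (Finset.univ.erase l)).coeff (N - 1 - (i : ℕ)) *
        complete k N (n + (((i : ℕ) : ℤ) - ((N : ℤ) - 1))) :=
    funext (varPow_eq_sum l)
  rw [h]
  exact shiftSum_sum_shift Finset.univ f (vanishesAtTop_complete N)
    (fun i : Fin N => (elemPoly k (Finset.univ.erase l)).coeff (N - 1 - (i : ℕ)))
    (fun i => ((i : ℕ) : ℤ) - ((N : ℤ) - 1)) n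

/-- The shift multiplies `x_l^n` by `x_l` only for `n ≥ 0`: at `n = -1` it leads from `0` to `1`.
Hence `n` is a natural number. -/
theorem shiftSum_varPow_succ {N : ℕ} (l : Fin N) (f : PowerSeries k) (n : ℕ) :
    shiftSum f (varPow l) ((n : ℤ) + 1) = MvPowerSeries.X l * shiftSum f (varPow l) n := by
  rw [← shiftSum_const_mul f (vanishesAtTop_varPow l)]
  refine tsum_congr fun m => ?_
  congr 1
  beta_reduce
  have h1 : (n : ℤ) + 1 + m = (n + m + 1 : ℕ) := by push_cast; ring
  have h2 : (n : ℤ) + m = (n + m : ℕ) := by push_cast; ring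
  rw [h1, h2, varPow_natCast, varPow_natCast, pow_succ']

theorem shiftSum_oneAddPow_varPow (β : k) {N : ℕ} (l : Fin N) (a : ℤ) (s n : ℕ) :
    shiftSum (oneAddPow β (a + s)) (varPow l) n =
      (1 + MvPowerSeries.C β * MvPowerSeries.X l) ^ s * shiftSum (oneAddPow β a) (varPow l) n := by
  induction s with
  | zero => simp
  | succ s ih =>
    rw [Nat.cast_succ, ← add_assoc, shiftSum_oneAddPow_add_one β _ (vanishesAtTop_varPow l),
      shiftSum_varPow_succ, ih, MvPowerSeries.smul_eq_C_mul]
    ring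

theorem shiftSum_oneAddPow_sub_varPow (β : k) {N : ℕ} (l : Fin N) (j s n : ℕ) :
    (1 + MvPowerSeries.C β * MvPowerSeries.X l) ^ s *
      shiftSum (oneAddPow β ((j : ℤ) - s)) (varPow l) n =
    MvPowerSeries.X l ^ n * (1 + MvPowerSeries.C β * MvPowerSeries.X l) ^ j := by
  have h := shiftSum_oneAddPow_varPow β l 0 j n
  rw [zero_add, shiftSum_oneAddPow_zero, varPow_natCast] at h
  rw [← shiftSum_oneAddPow_varPow, sub_add_cancel, h, mul_comm]

/-- The exponents `λ_j + N - 1 - j` of the ratio formula arise here: the sum over `i` is the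
expansion of `x_l^n` in the `h`'s. -/
theorem mul_elemMatrix {N : ℕ} (F : Fin N → PowerSeries k) (lam : ℕ → ℕ) (j l : Fin N) :
    ((Matrix.of fun j i : Fin N =>
      shiftSum (F j) (complete k N) ((lam j : ℤ) - ((j : ℕ) : ℤ) + ((i : ℕ) : ℤ))) *
        elemMatrix k N) j l =
      shiftSum (F j) (varPow l) ((lam j + (N - 1 - (j : ℕ)) : ℕ) : ℤ) := by
  rw [shiftSum_varPow_eq_sum, Matrix.mul_apply]
  refine Finset.sum_congr rfl fun i _ => ?_
  rw [Matrix.of_apply, elemMatrix, Matrix.of_apply, mul_comm]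
  congr 2
  have := j.2
  omega

/-- The matrix `(h_{i-j})` is unitriangular, and its product with `elemMatrix` is the Vandermonde
matrix, by `mul_elemMatrix` for the empty partition. -/
theorem det_elemMatrix (N : ℕ) :
    (elemMatrix k N).det = (ratioDen k N : MvPowerSeries (Fin N) k) := by
  set K : Matrix (Fin N) (Fin N) (MvPowerSeries (Fin N) k) := Matrix.of fun j i : Fin N =>
      shiftSum 1 (complete k N) (((0 : ℕ) : ℤ) - ((j : ℕ) : ℤ) + ((i : ℕ) : ℤ)) with hK
  have hK1 : K.det = 1 := by
    rw [Matrix.det_of_isUpperTriangular]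
    · simp [hK, shiftSum_one, complete_zero]
    · intro j i hij
      have : (i : ℕ) < j := hij
      rw [hK, Matrix.of_apply, shiftSum_one, complete_of_neg]
      omega
  rw [← det_X_pow, ← one_mul (elemMatrix k N).det, ← hK1, ← Matrix.det_mul]
  congr 1
  ext1 j l
  rw [hK, mul_elemMatrix (fun _ => 1) fun _ => 0, shiftSum_one, varPow_natCast, zero_add,
    Matrix.of_apply]

/-- After multiplication by `elemMatrix`, the scalar `∏ (1 + β x_l)^N` taken out of the determinant
is redistributed over the columns. In column `l` it cancels the negative part of `(1 + β S)^(j -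
N)`, leaving `(1 + β x_l)^j`. -/
theorem det_shiftSum_complete (β : k) (lam : ℕ → ℕ) (N : ℕ) :
    Matrix.det (Matrix.of fun j i : Fin N => oneAddProd β N *
      shiftSum (oneAddPow β (((j : ℕ) : ℤ) - (N : ℤ))) (complete k N)
        ((lam j : ℤ) - ((j : ℕ) : ℤ) + ((i : ℕ) : ℤ))) =
      (grothendieckPoly β lam N : MvPowerSeries (Fin N) k) := by
  set W : Matrix (Fin N) (Fin N) (MvPowerSeries (Fin N) k) := Matrix.of fun j i : Fin N =>
      shiftSum (oneAddPow β (((j : ℕ) : ℤ) - (N : ℤ))) (complete k N)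
        ((lam j : ℤ) - ((j : ℕ) : ℤ) + ((i : ℕ) : ℤ)) with hW
  have hD : (ratioDen k N : MvPowerSeries (Fin N) k) ≠ 0 := by
    rw [Ne, MvPolynomial.coe_eq_zero_iff]
    exact ratioDen_ne_zero N
  refine mul_right_cancel₀ hD ?_
  have hs : (Matrix.of fun j i : Fin N => oneAddProd β N *
      shiftSum (oneAddPow β (((j : ℕ) : ℤ) - (N : ℤ))) (complete k N)
        ((lam j : ℤ) - ((j : ℕ) : ℤ) + ((i : ℕ) : ℤ))) = oneAddProd β N • W := by
    ext1 j i
    simp [hW]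
  have hv : oneAddProd β N ^ N = ∏ l : Fin N,
      (1 + MvPowerSeries.C β * MvPowerSeries.X l : MvPowerSeries (Fin N) k) ^ N := by
    rw [Finset.prod_pow, oneAddProd]
  rw [← MvPolynomial.coe_mul, grothendieckPoly_mul_ratioDen, hs, Matrix.det_smul, Fintype.card_fin,
    mul_assoc, ← det_elemMatrix, ← Matrix.det_mul, hv, ← Matrix.det_mul_row, coe_ratioNum]
  congr 1
  ext1 j l
  rw [Matrix.of_apply, hW, mul_elemMatrix (fun j : Fin N => oneAddPow β (((j : ℕ) : ℤ) - (N : ℤ))),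
    shiftSum_oneAddPow_sub_varPow, Matrix.of_apply]

/-- The series `∏_l (1 + β x_l) ∑_m (-β) ^ m h_{n+m}`, which is `G_n(x_1, …, x_N)`. -/
noncomputable def finiteOneRow (β : k) (N : ℕ) (n : ℤ) : MvPowerSeries (Fin N) k :=
  oneAddProd β N * shiftSum (oneAddPow β (-1)) (complete k N) n

theorem vanishesAtTop_finiteOneRow (β : k) (N : ℕ) : VanishesAtTop (finiteOneRow β N) :=
  ((vanishesAtTop_complete N).shiftSum _).const_mul _

/-- The factor `(1 + β S)⁻¹` in `finiteOneRow` accounts for the difference between the exponents `i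
+ 1 - N` and `i - N`. -/
theorem det_shiftSum_finiteOneRow (β : k) (lam : ℕ → ℕ) (N : ℕ) :
    Matrix.det (Matrix.of fun i j : Fin N =>
      shiftSum (oneAddPow β (((i : ℕ) : ℤ) + 1 - (N : ℤ))) (finiteOneRow β N)
        ((lam i : ℤ) - ((i : ℕ) : ℤ) + ((j : ℕ) : ℤ))) =
      (grothendieckPoly β lam N : MvPowerSeries (Fin N) k) := by
  rw [← det_shiftSum_complete]
  congr 1
  ext1 i j
  have hh := vanishesAtTop_complete (k := k) N
  have h : ((i : ℕ) : ℤ) - (N : ℤ) = ((i : ℕ) : ℤ) + 1 - (N : ℤ) + -1 := by ring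
  rw [Matrix.of_apply, Matrix.of_apply, h, oneAddPow_add, shiftSum_mul _ _ hh,
    ← shiftSum_const_mul _ (hh.shiftSum _)]
  rfl

/-- Applying `1 + β S` gives back `h`, which is zero at negative indices; there the family is
therefore geometric with ratio `-β`. -/
theorem shiftSum_oneAddPow_neg_one_complete (β : k) (N n : ℕ) :
    shiftSum (oneAddPow β (-1)) (complete k N) (-(n : ℤ)) =
      MvPowerSeries.C ((-β) ^ n) * shiftSum (oneAddPow β (-1)) (complete k N) 0 := by
  induction n with
  | zero => simp
  | succ n ih =>
    have h := shiftSum_oneAddPow_add_one β (-1) (vanishesAtTop_complete N) (-((n + 1 : ℕ) : ℤ))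
    rw [neg_add_cancel, shiftSum_oneAddPow_zero, complete_of_neg N (by omega),
      show (-((n + 1 : ℕ) : ℤ)) + 1 = -(n : ℤ) by push_cast; ring, ih,
      MvPowerSeries.smul_eq_C_mul] at h
    rw [eq_neg_of_add_eq_zero_left h.symm, pow_succ]
    simp only [map_mul, map_neg, map_pow]
    ring

/-- Apply `(1 + β S)⁻¹` to the identity `∑_q e_q h_{n-q} = δ_{n,0}`, where `e_q` are the
coefficients of `∏ (1 - x_l z)`, and read it at `n = 0`. By the geometric behaviour at indices `-q`,
the left side is the value at `0` times `∏ (1 - x_l z)` evaluated at `z = -β`, that is `∏ (1 + β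
x_l)`. -/
theorem finiteOneRow_zero (β : k) (N : ℕ) : finiteOneRow β N 0 = 1 := by
  have hE : zCoeff (1 : PowerSeries (MvPowerSeries (Fin N) k)) = fun n =>
      ∑ q ∈ Finset.range (N + 1), (elemPoly k (Finset.univ : Finset (Fin N))).coeff q *
        complete k N (n + -(q : ℤ)) := by
    funext n
    rw [← elemPoly_mul_completeSeries, zCoeff_mul (K := N + 1)]
    · simp_rw [Polynomial.coeff_coe, ← sub_eq_add_neg, complete]
    · intro q hq
      rw [Polynomial.coeff_coe, coeff_elemPoly]
      rw [Finset.card_univ, Fintype.card_fin]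
      omega
  have h := shiftSum_sum_shift (Finset.range (N + 1)) (oneAddPow β (-1)) (vanishesAtTop_complete N)
    (elemPoly k (Finset.univ : Finset (Fin N))).coeff (fun q => -(q : ℤ)) 0
  rw [← hE] at h
  have hl : shiftSum (oneAddPow β (-1)) (zCoeff (1 : PowerSeries (MvPowerSeries (Fin N) k))) 0
      = 1 := by
    unfold shiftSum
    rw [tsum_eq_single 0]
    · rw [zero_add, zCoeff_natCast, coeff_oneAddPow_neg_one]
      simp
    · intro m hm
      rw [zero_add, zCoeff_natCast, PowerSeries.coeff_one, if_neg hm, smul_zero]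
  have hev : (elemPoly k (Finset.univ : Finset (Fin N))).eval (MvPowerSeries.C (-β)) =
      oneAddProd β N := by
    rw [elemPoly, Polynomial.eval_prod, oneAddProd]
    refine Finset.prod_congr rfl fun l _ => ?_
    simp only [Polynomial.eval_sub, Polynomial.eval_one, Polynomial.eval_mul, Polynomial.eval_C,
      Polynomial.eval_X, map_neg]
    ring
  rw [finiteOneRow, ← hl, h, ← hev, Polynomial.eval_eq_sum_range' (n := N + 1), Finset.sum_mul]
  · refine Finset.sum_congr rfl fun q _ => ?_
    rw [zero_add, shiftSum_oneAddPow_neg_one_complete, map_pow, mul_assoc]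
  · rw [Nat.lt_succ_iff, Polynomial.natDegree_le_iff_coeff_eq_zero]
    intro q hq
    rw [coeff_elemPoly]
    rwa [Finset.card_univ, Fintype.card_fin]

theorem finiteOneRow_neg (β : k) (N n : ℕ) :
    finiteOneRow β N (-(n : ℤ)) = MvPowerSeries.C ((-β) ^ n) := by
  have h := finiteOneRow_zero β N
  rw [finiteOneRow] at h ⊢
  rw [shiftSum_oneAddPow_neg_one_complete, mul_left_comm, h, mul_one]

/-- The determinantal formula in finitely many variables. -/
theorem det_shiftSum_finiteOneRow_of_le (β : k) (lam : ℕ → ℕ) {r N : ℕ} (hrN : r ≤ N)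
    (hr : ∀ i, r ≤ i → lam i = 0) :
    Matrix.det (Matrix.of fun i j : Fin r =>
      shiftSum (oneAddPow β (((i : ℕ) : ℤ) + 1 - (r : ℤ))) (finiteOneRow β N)
        ((lam i : ℤ) - ((i : ℕ) : ℤ) + ((j : ℕ) : ℤ))) =
      (grothendieckPoly β lam N : MvPowerSeries (Fin N) k) := by
  rw [← det_shiftSum_finiteOneRow, det_shiftSum_eq β (vanishesAtTop_finiteOneRow β N)
    (finiteOneRow_neg β N) lam hrN hr]

end Det

end Finite

/-! ### Passage to infinitely many variables. -/

section Restrict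

variable {k : Type*} [Field k]

variable (k) in
/-- The specialization `F(x_1, …, x_n, 0, 0, …)` as an algebra homomorphism. -/
noncomputable def restrictHom (n : ℕ) : MvPowerSeries ℕ k →ₐ[k] MvPowerSeries (Fin n) k :=
  MvPowerSeries.killCompl Fin.valEmbedding

theorem restrictHom_apply (n : ℕ) (F : MvPowerSeries ℕ k) : restrictHom k n F = restrictVars n F :=
  rfl

theorem coeff_restrictHom (n : ℕ) (F : MvPowerSeries ℕ k) (e : Fin n →₀ ℕ) :
    MvPowerSeries.coeff e (restrictHom k n F) =
      MvPowerSeries.coeff (Finsupp.embDomain Fin.valEmbedding e) F :=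
  MvPowerSeries.coeff_killCompl _ _

/-- A monomial involves finitely many variables, so it survives every restriction to sufficiently
many of them. `N` and `e` are chosen independently of `F`, so whole families and sums can be tested
in one restriction. -/
theorem exists_coeff_eq_coeff_restrictHom (N₀ : ℕ) (d : ℕ →₀ ℕ) :
    ∃ N, N₀ ≤ N ∧ ∃ e : Fin N →₀ ℕ, ∀ F : MvPowerSeries ℕ k,
      MvPowerSeries.coeff d F = MvPowerSeries.coeff e (restrictHom k N F) := by
  obtain ⟨M, hM⟩ := d.support.exists_le
  refine ⟨max N₀ (M + 1), le_max_left _ _, d.comapDomain Fin.val Fin.val_injective.injOn,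
    fun F => ?_⟩
  rw [coeff_restrictHom]
  congr 2
  refine (Finsupp.embDomain_comapDomain (f := Fin.valEmbedding) fun i hi => ?_).symm
  have := hM i hi
  exact ⟨⟨i, by omega⟩, rfl⟩

theorem ext_restrictHom (N₀ : ℕ) {F G : MvPowerSeries ℕ k}
    (h : ∀ N, N₀ ≤ N → restrictHom k N F = restrictHom k N G) : F = G := by
  ext d
  obtain ⟨N, hN, e, he⟩ := exists_coeff_eq_coeff_restrictHom (k := k) N₀ d
  rw [he, he, h N hN]

theorem restrictHom_X (N : ℕ) (i : Fin N) :
    restrictHom k N (MvPowerSeries.X (i : ℕ)) = MvPowerSeries.X i :=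
  MvPowerSeries.killCompl_X (e := Fin.valEmbedding) i

theorem restrictHom_X_of_le {N i : ℕ} (h : N ≤ i) :
    restrictHom k N (MvPowerSeries.X i) = 0 :=
  MvPowerSeries.killCompl_X_eq_zero (by
    rintro ⟨j, rfl⟩
    exact absurd j.2 (not_lt.2 h))

theorem restrictHom_C (N : ℕ) (a : k) :
    restrictHom k N (MvPowerSeries.C a) = MvPowerSeries.C a :=
  MvPowerSeries.killCompl_C a

theorem genFactor_eq (β : k) (i : ℕ) :
    genFactor β i = PowerSeries.C (1 + MvPowerSeries.C β * MvPowerSeries.X i) *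
      geomSeries (MvPowerSeries.X i) := by
  rw [← genFactor_mul, mul_assoc, mul_comm (1 - _), geomSeries_mul, mul_one]

theorem map_geomSeries {R S : Type*} [CommRing R] [CommRing S] (f : R →+* S) (x : R) :
    PowerSeries.map f (geomSeries x) = geomSeries (f x) := by
  ext p
  simp [geomSeries]

theorem zCoeff_map {R S : Type*} [CommRing R] [CommRing S] (f : R →+* S) (F : PowerSeries R)
    (n : ℤ) : zCoeff (PowerSeries.map f F) n = f (zCoeff F n) := by
  unfold zCoeff
  split_ifs <;> simp

theorem map_restrictHom_genFactor (β : k) (N : ℕ) (i : Fin N) :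
    PowerSeries.map (restrictHom k N : MvPowerSeries ℕ k →+* MvPowerSeries (Fin N) k) (genFactor β i) =
      PowerSeries.C (1 + MvPowerSeries.C β * MvPowerSeries.X i) *
        geomSeries (MvPowerSeries.X i) := by
  rw [genFactor_eq, map_mul, map_geomSeries, PowerSeries.map_C]
  simp [restrictHom_X, restrictHom_C]

theorem map_restrictHom_genFactor_of_le (β : k) {N i : ℕ} (h : N ≤ i) :
    PowerSeries.map (restrictHom k N : MvPowerSeries ℕ k →+* MvPowerSeries (Fin N) k) (genFactor β i) = 1 := by
  rw [genFactor_eq, map_mul, map_geomSeries, PowerSeries.map_C]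
  simp only [AlgHom.coe_toRingHom, map_add, map_one, map_mul, restrictHom_X_of_le h, mul_zero,
    add_zero, one_mul]
  simpa using geomSeries_mul (0 : MvPowerSeries (Fin N) k)

/-- The factor `genFactor β i` is congruent to `1` modulo `x_i`, and a monomial without `x_i` does
not see multiples of `x_i`. -/
theorem coeff_coeff_genFactor_mul (β : k) (i : ℕ) (Y : PowerSeries (MvPowerSeries ℕ k))
    (d : ℕ →₀ ℕ) (hd : d i = 0) (p : ℕ) :
    MvPowerSeries.coeff d (PowerSeries.coeff p (genFactor β i * Y)) =
      MvPowerSeries.coeff d (PowerSeries.coeff p Y) := by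
  have h : genFactor β i * Y = Y + PowerSeries.C (MvPowerSeries.X i) *
      ((PowerSeries.C (MvPowerSeries.C β) + genFactor β i * PowerSeries.X) * Y) := by
    have h1 := genFactor_mul β i
    have h2 : genFactor β i = 1 + PowerSeries.C (MvPowerSeries.X i) *
        (PowerSeries.C (MvPowerSeries.C β) + genFactor β i * PowerSeries.X) := by
      rw [map_add, map_mul, map_one] at h1
      linear_combination h1
    conv_lhs => rw [h2]
    ring
  rw [h, map_add, map_add, PowerSeries.coeff_C_mul, MvPowerSeries.X,
    MvPowerSeries.coeff_monomial_mul, if_neg, add_zero]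
  intro hle
  have := hle i
  simp [hd] at this

theorem coeff_coeff_prod_genFactor (β : k) {s t : Finset ℕ} (hst : s ⊆ t) (d : ℕ →₀ ℕ)
    (hs : d.support ⊆ s) (p : ℕ) :
    MvPowerSeries.coeff d (PowerSeries.coeff p (∏ i ∈ t, genFactor β i)) =
      MvPowerSeries.coeff d (PowerSeries.coeff p (∏ i ∈ s, genFactor β i)) := by
  classical
  have key : ∀ u : Finset ℕ, Disjoint u s →
      MvPowerSeries.coeff d (PowerSeries.coeff p ((∏ i ∈ u, genFactor β i) *
        ∏ i ∈ s, genFactor β i)) =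
      MvPowerSeries.coeff d (PowerSeries.coeff p (∏ i ∈ s, genFactor β i)) := by
    intro u
    induction u using Finset.induction_on with
    | empty => simp
    | insert i u hi ih =>
      intro hu
      rw [Finset.disjoint_insert_left] at hu
      rw [Finset.prod_insert hi, mul_assoc, coeff_coeff_genFactor_mul, ih hu.2]
      by_contra h
      exact hu.1 (hs (Finsupp.mem_support_iff.2 h))
  rw [← key (t \ s) Finset.sdiff_disjoint, Finset.prod_sdiff hst]

theorem rowLen_eq_zero (μ : YoungDiagram) {i : ℕ} (hi : μ.colLen 0 ≤ i) : μ.rowLen i = 0 := by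
  by_contra h
  have hm : (i, 0) ∈ μ := YoungDiagram.mem_iff_lt_rowLen.2 (Nat.pos_of_ne_zero h)
  exact absurd (YoungDiagram.mem_iff_lt_colLen.1 hm) (not_lt.2 hi)

theorem colLen_ofRowLens_singleton (n : ℕ) (h : [n].SortedGE) :
    (YoungDiagram.ofRowLens [n] h).colLen 0 ≤ 1 := by
  by_contra hlt
  have := YoungDiagram.mem_iff_lt_colLen.2 (not_le.1 hlt)
  rw [YoungDiagram.mem_ofRowLens] at this
  simp at this

theorem rowLen_ofRowLens_singleton (n : ℕ) (h : [n].SortedGE) :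
    (YoungDiagram.ofRowLens [n] h).rowLen 0 = n :=
  YoungDiagram.rowLen_ofRowLens (hw := h) (⟨0, by simp⟩ : Fin [n].length)

theorem detTerm_eq (β : k) (μ : YoungDiagram) (r : ℕ) (i j : Fin r) (m : ℕ) :
    detTerm β μ r i j m = PowerSeries.coeff m (oneAddPow β (((i : ℕ) : ℤ) + 1 - (r : ℤ))) •
      oneRow β ((μ.rowLen i : ℤ) - ((i : ℕ) : ℤ) + ((j : ℕ) : ℤ) + (m : ℤ)) := by
  rw [coeff_oneAddPow, detTerm]

variable [TopologicalSpace k]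

theorem continuous_restrictHom (N : ℕ) : Continuous (restrictHom k N) :=
  continuous_pi fun e =>
    (MvPowerSeries.WithPiTopology.continuous_coeff k
      (Finsupp.embDomain Fin.valEmbedding e)).congr fun F => (coeff_restrictHom N F e).symm

theorem hasSum_of_restrictHom (N₀ : ℕ) {F : ℕ → MvPowerSeries ℕ k} {S : MvPowerSeries ℕ k}
    (h : ∀ N, N₀ ≤ N → HasSum (fun m => restrictHom k N (F m)) (restrictHom k N S)) :
    HasSum F S := by
  rw [MvPowerSeries.WithPiTopology.hasSum_iff_hasSum_coeff]
  intro d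
  obtain ⟨N, hN, e, he⟩ := exists_coeff_eq_coeff_restrictHom (k := k) N₀ d
  simp_rw [he]
  exact MvPowerSeries.WithPiTopology.hasSum_iff_hasSum_coeff.1 (h N hN) e

theorem multipliable_genFactor (β : k) : Multipliable fun i : ℕ => genFactor β i := by
  -- The coefficient at `d` of a finite partial product is constant once the product contains every
  -- factor indexed by the support of `d`; this constant defines the limit.
  let L : ℕ → MvPowerSeries ℕ k := fun p d =>
    MvPowerSeries.coeff d (PowerSeries.coeff p (∏ i ∈ d.support, genFactor β i))
  refine ⟨PowerSeries.mk L, ?_⟩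
  rw [HasProd, SummationFilter.unconditional_filter,
    PowerSeries.WithPiTopology.tendsto_iff_coeff_tendsto]
  intro p
  rw [MvPowerSeries.WithPiTopology.tendsto_iff_coeff_tendsto]
  intro d
  refine tendsto_nhds_of_eventually_eq ?_
  filter_upwards [Filter.eventually_ge_atTop d.support] with t ht
  rw [coeff_coeff_prod_genFactor β ht d subset_rfl, PowerSeries.coeff_mk]
  rfl

variable [DiscreteTopology k]

theorem map_restrictHom_tprod_genFactor (β : k) (N : ℕ) :
    PowerSeries.map (restrictHom k N : MvPowerSeries ℕ k →+* MvPowerSeries (Fin N) k) (∏' i : ℕ, genFactor β i) =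
      PowerSeries.C (oneAddProd β N) * completeSeries k N := by
  have hc : Continuous (PowerSeries.map (restrictHom k N : MvPowerSeries ℕ k →+* MvPowerSeries (Fin N) k)) := by
    refine continuous_pi fun e => ?_
    have h : ∀ F : PowerSeries (MvPowerSeries ℕ k),
        PowerSeries.map (restrictHom k N : MvPowerSeries ℕ k →+* MvPowerSeries (Fin N) k) F e =
          restrictHom k N (PowerSeries.coeff (e ()) F) := by
      intro F
      have := PowerSeries.coeff_map (restrictHom k N : MvPowerSeries ℕ k →+* MvPowerSeries (Fin N) k) (e ()) F
      rw [PowerSeries.coeff_def (s := e) rfl] at this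
      exact this
    simp_rw [h]
    exact (continuous_restrictHom N).comp (PowerSeries.WithPiTopology.continuous_coeff _ _)
  have h1 := (multipliable_genFactor β).hasProd.map
    (PowerSeries.map (restrictHom k N : MvPowerSeries ℕ k →+* MvPowerSeries (Fin N) k)) hc
  -- Setting `x_i = 0` for `i ≥ N` turns all factors but the first `N` into `1`, so the infinite
  -- product becomes finite.
  have h2 := hasProd_prod_of_ne_finset_one (L := SummationFilter.unconditional ℕ) (s := Finset.range N)
    (f := PowerSeries.map (restrictHom k N : MvPowerSeries ℕ k →+* MvPowerSeries (Fin N) k) ∘ fun i => genFactor β i)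
    fun i hi => map_restrictHom_genFactor_of_le β (by simpa using hi)
  rw [h1.unique h2, Finset.prod_range, oneAddProd, completeSeries, map_prod,
    ← Finset.prod_mul_distrib]
  exact Finset.prod_congr rfl fun i _ => map_restrictHom_genFactor β N i

theorem restrictHom_zCoeff_tprod_genFactor (β : k) (N : ℕ) (n : ℤ) :
    restrictHom k N (zCoeff (∏' i : ℕ, genFactor β i) n) = oneAddProd β N * complete k N n := by
  have h := zCoeff_map (restrictHom k N : MvPowerSeries ℕ k →+* MvPowerSeries (Fin N) k) (∏' i : ℕ, genFactor β i) n
  rw [map_restrictHom_tprod_genFactor, zCoeff_C_mul] at h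
  exact h.symm

/-- For `n ≥ 0` this is the determinantal formula with `r = 1`, whose single entry carries `(1 + β
S)^0`; for `n < 0` it is `finiteOneRow_neg`. -/
theorem restrictHom_oneRow (β : k) {N : ℕ} (hN : 1 ≤ N) (n : ℤ) :
    restrictHom k N (oneRow β n) = finiteOneRow β N n := by
  obtain n | n := n
  · have hw : [n].SortedGE := (List.pairwise_singleton _ n).sortedGE
    have hl := colLen_ofRowLens_singleton n hw
    have h := det_shiftSum_finiteOneRow_of_le β (YoungDiagram.ofRowLens [n] hw).rowLen hN
      fun i hi => rowLen_eq_zero _ (hl.trans hi)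
    rw [oneRow, restrictHom_apply, restrictVars_stableGrothendieck _ _ _ (hl.trans hN), ← h,
      Matrix.det_fin_one, Matrix.of_apply]
    simp [rowLen_ofRowLens_singleton, shiftSum_oneAddPow_zero]
  · rw [oneRow, restrictHom_C, ← finiteOneRow_neg β N, Int.negSucc_eq]
    simp

theorem vanishesAtTop_oneRow (β : k) : VanishesAtTop (oneRow β) := by
  intro d
  obtain ⟨N, hN, e, he⟩ := exists_coeff_eq_coeff_restrictHom (k := k) 1 d
  simp_rw [he, restrictHom_oneRow β hN]
  exact vanishesAtTop_finiteOneRow β N e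

theorem hasSum_oneRow (β : k) (n : ℤ) :
    HasSum (fun m : ℕ => ((-β) ^ m) • zCoeff (∏' i : ℕ, genFactor β i) (n + (m : ℤ)))
      (oneRow β n) := by
  refine hasSum_of_restrictHom 1 fun N hN => ?_
  simp_rw [map_smul, restrictHom_zCoeff_tprod_genFactor, restrictHom_oneRow β hN]
  have h := (hasSum_shiftSum (oneAddPow β (-1)) (vanishesAtTop_complete (k := k) N) n).mul_left
    (oneAddProd β N)
  simp only [coeff_oneAddPow_neg_one, mul_smul_comm] at h
  exact h

theorem hasSum_detTerm (β : k) (μ : YoungDiagram) (r : ℕ) (i j : Fin r) :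
    HasSum (detTerm β μ r i j) (shiftSum (oneAddPow β (((i : ℕ) : ℤ) + 1 - (r : ℤ))) (oneRow β)
      ((μ.rowLen i : ℤ) - ((i : ℕ) : ℤ) + ((j : ℕ) : ℤ))) := by
  simp_rw [funext (detTerm_eq β μ r i j)]
  exact hasSum_shiftSum _ (vanishesAtTop_oneRow β) _

theorem restrictHom_shiftSum_oneRow (β : k) {N : ℕ} (hN : 1 ≤ N) (f : PowerSeries k) (n : ℤ) :
    restrictHom k N (shiftSum f (oneRow β) n) = shiftSum f (finiteOneRow β N) n := by
  have h := (hasSum_shiftSum f (vanishesAtTop_oneRow β) n).map (restrictHom k N)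
    (continuous_restrictHom N)
  refine h.unique ?_
  simpa only [Function.comp_def, map_smul, restrictHom_oneRow β hN] using
    hasSum_shiftSum f (vanishesAtTop_finiteOneRow β N) n

theorem stableGrothendieck_eq_det (β : k) (μ : YoungDiagram) (r : ℕ) (hr : μ.colLen 0 ≤ r) :
    stableGrothendieck β μ = Matrix.det (Matrix.of fun i j : Fin r =>
      ∑' m : ℕ, detTerm β μ r i j m) := by
  -- The finite formula needs `r ≤ N`, and the restriction of the one-row functions needs `1 ≤ N`.
  refine ext_restrictHom (max r 1) fun N hN => ?_
  have hrN := (le_max_left _ _).trans hN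
  rw [restrictHom_apply, restrictVars_stableGrothendieck _ _ _ (hr.trans hrN),
    ← det_shiftSum_finiteOneRow_of_le β μ.rowLen hrN fun i hi => rowLen_eq_zero μ (hr.trans hi),
    AlgHom.map_det]
  congr 1
  ext1 i j
  rw [AlgHom.mapMatrix_apply, Matrix.map_apply, Matrix.of_apply, Matrix.of_apply,
    (hasSum_detTerm β μ r i j).tsum_eq, restrictHom_shiftSum_oneRow β ((le_max_right _ _).trans hN)]

end Restrict

end StableGrothendieck

theorem mainTheorem3 {k : Type*} [Field k] [TopologicalSpace k] [DiscreteTopology k] (β : k) :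
    (Multipliable (fun i : ℕ => StableGrothendieck.genFactor β i) ∧
      ∀ n : ℤ, HasSum
        (fun m : ℕ => ((-β) ^ m) • StableGrothendieck.zCoeff
          (∏' i : ℕ, StableGrothendieck.genFactor β i) (n + (m : ℤ)))
        (StableGrothendieck.oneRow β n)) ∧
    ∀ (μ : YoungDiagram) (r : ℕ), μ.colLen 0 ≤ r →
      (∀ i j : Fin r, Summable (StableGrothendieck.detTerm β μ r i j)) ∧
      StableGrothendieck.stableGrothendieck β μ =
        Matrix.det (Matrix.of fun i j : Fin r =>
          ∑' m : ℕ, StableGrothendieck.detTerm β μ r i j m) :=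
  ⟨⟨StableGrothendieck.multipliable_genFactor β, StableGrothendieck.hasSum_oneRow β⟩,
    fun μ r hr => ⟨fun i j => (StableGrothendieck.hasSum_detTerm β μ r i j).summable,
      StableGrothendieck.stableGrothendieck_eq_det β μ r hr⟩⟩
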